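/- Let $\alpha\in\mathbb R\setminus\mathbb Q$ and let $R_\alpha(x)=x+\alpha$ be the rotation of $S^1=\mathbb R/\mathbb Z$. For $u,v\in S^1$ let $\ell([u,v])\in[0,1)$ be the length of the positively oriented arc from $u$ to $v$. For $n\ge 2$ let $r_n\alpha$ and $s_n\alpha$ ($1\le r_n,s_n\le n$) be the points of $\{0,\alpha,\dots,n\alpha\}$ adjacent to $0$ on the left and on the right, and put $a_n=\ell([r_n\alpha,0])$, $b_n=\ell([0,s_n\alpha])$, $I_n=(r_n\alpha,s_n\alpha)$ and $J_n=((n-s_n)\alpha,(n-r_n)\alpha)$. The wandering time $w(n)$ is the largest integer $w\ge 0$ such that the arcs $I_n,R_\alpha(I_n),\dots,R_\alpha^w(I_n),R_\alpha^{-w}(J_n),\dots,R_\alpha^{-1}(J_n),J_n$ are pairwise disjoint (it exists for all the large times $n=k_i$ considered below). A sequence of characteristic times of $\alpha$ is a sequence $k_i=N_i-1$, where $(N_i)$ is a strictly increasing sequence of integers such that, for every $i$, with $N=N_i$: $r_N+s_N=N+1$, $\frac{a_N}{b_N}\in[\frac12,2]$ (so that $N+1$ is a closest return time), and either $a_N<b_N$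 and $r_N\le 2s_N$, or $a_N>b_N$ and $s_N\le 2r_N$. Put $w_i=w(k_i)$. For an orientation preserving homeomorphism $f$ of $S^1$ without periodic points, $x\in S^1$ and $n\ge2$, let $[a,b]$ and $[c,d]$ be the arcs with end points in $\{x,f(x),\dots,f^n(x)\}$ such that $x$ is the only point of this set in the open arc $(a,b)$ and $f^n(x)$ the only one in $(c,d)$. The initial and final ratio of the orbit segment $x,\dots,f^n(x)$ are $$\frac{\ell([a,x])}{\ell([x,b])}\quad\text{and}\quad\frac{\ell([c,f^n(x)])}{\ell([f^n(x),d])}.$$ \textbf{Lemma.} Sequences of characteristic times of $\alpha$ exist. Let $(k_i)$ be any of them and let $f$ be an orientation preserving $C^1$-diffeomorphism of $S^1$ with rotation number $\alpha$ modulo $\mathbb Z$. Then for every $\lambda>1$ there is $i(\lambda)$ such that for every $i\ge i(\lambda)$ and every $x\in S^1$ the initial and final ratios of the characteristic segment $x,f(x),\dots,f^{k_i}(x)$ belong to $[\lambda^{-w_i},\lambda^{w_i}]$. -/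

import Mathlib

/-- Length of the arc of the circle `ℝ/ℤ` going from `u` to `v` in the positive direction;
it lies in `[0, 1)`. -/
noncomputable def arcLength (u v : UnitAddCircle) : ℝ :=
  (AddCircle.equivIco (1 : ℝ) 0 (v - u) : ℝ)

/-- `F¹_α`: the orientation preserving `C¹`-diffeomorphisms `f` of the circle with rotation number
`α ∈ ℝ/ℤ`. Such an `f` is the projection of an invertible lift `F : ℝ → ℝ` with
`F (t + 1) = F t + 1`, where `F` and its inverse are `C¹`; its rotation number is the class
modulo `ℤ` of the translation number of `F`. -/
def FOne (α : UnitAddCircle) : Set (UnitAddCircle → UnitAddCircle) :=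
  {f | ∃ F : CircleDeg1Liftˣ,
    ContDiff ℝ 1 (F : CircleDeg1Lift) ∧
    ContDiff ℝ 1 ((F⁻¹ : CircleDeg1Liftˣ) : CircleDeg1Lift) ∧
    (∀ t : ℝ, f (t : UnitAddCircle) = (((F : CircleDeg1Lift) t : ℝ) : UnitAddCircle)) ∧
    ((CircleDeg1Lift.translationNumber (F : CircleDeg1Lift) : ℝ) : UnitAddCircle) = α}

/-- The orbit segment `{x, f x, …, fⁿ x}`. -/
def orbitSegment (f : UnitAddCircle → UnitAddCircle) (n : ℕ) (x : UnitAddCircle) :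
    Set UnitAddCircle :=
  {y | ∃ j : ℕ, j ≤ n ∧ y = f^[j] x}

/-- `[a, b]` is the basic interval of the point `p` of `S`: its end points lie in `S`, and `p` is
the only point of `S` in the open arc from `a` to `b`. -/
def IsBasicInterval (S : Set UnitAddCircle) (p a b : UnitAddCircle) : Prop :=
  a ∈ S ∧ b ∈ S ∧ Set.cIoo a b ∩ S = {p}

/-- `ρ = ℓ([a, x]) / ℓ([x, b])`, with `[a, b]` the initial basic interval of the orbit segment
`{x, …, fⁿ x}`. -/
def IsInitialRatio (f : UnitAddCircle → UnitAddCircle) (n : ℕ) (x : UnitAddCircle) (ρ : ℝ) :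
    Prop :=
  ∃ a b : UnitAddCircle, IsBasicInterval (orbitSegment f n x) x a b ∧
    ρ = arcLength a x / arcLength x b

/-- `ρ = ℓ([c, fⁿ x]) / ℓ([fⁿ x, d])`, with `[c, d]` the final basic interval of the orbit segment
`{x, …, fⁿ x}`. -/
def IsFinalRatio (f : UnitAddCircle → UnitAddCircle) (n : ℕ) (x : UnitAddCircle) (ρ : ℝ) :
    Prop :=
  ∃ c d : UnitAddCircle, IsBasicInterval (orbitSegment f n x) (f^[n] x) c d ∧
    ρ = arcLength c (f^[n] x) / arcLength (f^[n] x) d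

/-- `r_n ∈ {1, …, n}`: the point `r_n α` precedes `0` among the points `0, α, …, nα`, that is, no
point of this orbit segment lies in the open arc from `r_n α` to `0`. (For irrational `α` and
`n ≥ 1` there is exactly one such index.) -/
noncomputable def leftTime (α : UnitAddCircle) (n : ℕ) : ℕ :=
  sInf {r : ℕ | 1 ≤ r ∧ r ≤ n ∧ ∀ j : ℕ, j ≤ n → j • α ∉ Set.cIoo (r • α) 0}

/-- `s_n ∈ {1, …, n}`: the point `s_n α` follows `0` among the points `0, α, …, nα`, that is, no
point of this orbit segment lies in the open arc from `0` to `s_n α`. (For irrational `α` and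
`n ≥ 1` there is exactly one such index.) -/
noncomputable def rightTime (α : UnitAddCircle) (n : ℕ) : ℕ :=
  sInf {s : ℕ | 1 ≤ s ∧ s ≤ n ∧ ∀ j : ℕ, j ≤ n → j • α ∉ Set.cIoo 0 (s • α)}

/-- `a_n`, the length of the arc from `r_n α` to `0`. -/
noncomputable def leftGap (α : UnitAddCircle) (n : ℕ) : ℝ := arcLength (leftTime α n • α) 0

/-- `b_n`, the length of the arc from `0` to `s_n α`. -/
noncomputable def rightGap (α : UnitAddCircle) (n : ℕ) : ℝ := arcLength 0 (rightTime α n • α)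

/-- The open arc `I_n = (r_n α, s_n α)`, which contains `0`. -/
noncomputable def arcI (α : UnitAddCircle) (n : ℕ) : Set UnitAddCircle :=
  Set.cIoo (leftTime α n • α) (rightTime α n • α)

/-- The open arc `J_n = ((n - s_n) α, (n - r_n) α)`, which contains `nα`. -/
noncomputable def arcJ (α : UnitAddCircle) (n : ℕ) : Set UnitAddCircle :=
  Set.cIoo (((n : ℤ) - rightTime α n) • α) (((n : ℤ) - leftTime α n) • α)

/-- The image of `A` under the `m`-th iterate of the rotation by `α`. -/
def rotateSet (α : UnitAddCircle) (m : ℤ) (A : Set UnitAddCircle) : Set UnitAddCircle :=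
  (fun z => z + m • α) '' A

/-- The arcs `I_n, R_α(I_n), …, R_α^w(I_n), R_α^{-w}(J_n), …, J_n` are pairwise disjoint. -/
def WandersFor (α : UnitAddCircle) (n w : ℕ) : Prop :=
  (∀ i j : ℕ, i ≤ w → j ≤ w → i ≠ j →
    Disjoint (rotateSet α i (arcI α n)) (rotateSet α j (arcI α n))) ∧
  (∀ i j : ℕ, i ≤ w → j ≤ w → i ≠ j →
    Disjoint (rotateSet α (-(i : ℤ)) (arcJ α n)) (rotateSet α (-(j : ℤ)) (arcJ α n))) ∧
  (∀ i j : ℕ, i ≤ w → j ≤ w →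
    Disjoint (rotateSet α i (arcI α n)) (rotateSet α (-(j : ℤ)) (arcJ α n)))

/-- The wandering time `w(n)`: the largest `w` for which the above arcs are pairwise disjoint. -/
noncomputable def wanderingTime (α : UnitAddCircle) (n : ℕ) : ℕ :=
  sSup {w : ℕ | WandersFor α n w}

/-- `n + 1` is a closest return time of the rotation by `α`: the point `(n + 1) α` falls into
`[-a_n, b_n]`, that is `r_n + s_n = n + 1`, and `a_n / b_n ∈ [1/2, 2]`. -/
def IsBeforeClosestReturn (α : UnitAddCircle) (n : ℕ) : Prop :=
  leftTime α n + rightTime α n = n + 1 ∧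
    leftGap α n / rightGap α n ∈ Set.Icc (1 / 2 : ℝ) 2

/-- The times `N` from which the characteristic times `N - 1` are built: `N + 1` is a closest
return time, and either `a_N < b_N` and `r_N ≤ 2 s_N`, or `a_N > b_N` and `s_N ≤ 2 r_N`. -/
def IsPreCharacteristic (α : UnitAddCircle) (N : ℕ) : Prop :=
  IsBeforeClosestReturn α N ∧
    ((leftGap α N < rightGap α N ∧ leftTime α N ≤ 2 * rightTime α N) ∨
      (rightGap α N < leftGap α N ∧ rightTime α N ≤ 2 * leftTime α N))

/-- `k` is a sequence of characteristic times of `α`: `k i = N i - 1` for a strictly increasing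
sequence `N` of times as above. -/
def IsCharacteristicSequence (α : UnitAddCircle) (k : ℕ → ℕ) : Prop :=
  ∃ N : ℕ → ℕ, StrictMono N ∧ (∀ i, IsPreCharacteristic α (N i)) ∧ ∀ i, k i = N i - 1

/-!
The neighbours `r τ` and `s τ` of `0`, at distances `a` and `b`, evolve by the subtractive Euclidean
algorithm: the shorter gap is subtracted from the longer one and the times are added. At a
characteristic time two steps of the rotation across the shorter gap cover the longer one, and they
take at most `4 * min r s` iterates. A diffeomorphism with rotation number `τ` orders its orbits in
the same way, so its ratios are bounded by the Lipschitz constant of that many iterates.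

This constant is subexponential. Images of a short arc under `q` consecutive iterates are disjoint,
so the lengths of its first `n` images add up to at most `n / q + 1`, and by uniform continuity the
logarithm of the derivative of the `n`-th iterate varies by `o(n)` on the arc; by the mean value
theorem the derivative is bounded at some point of the arc.

Finally `min r s ≤ 2 * w + 4`, because the translates of `I` by distinct multiples of `τ`, the
multipliers differing by less than `min r s`, are disjoint.
-/

/-! ### Arcs of the circle -/

section Circle

theorem coe_eq_coe_iff_exists_add_intCast {x y : ℝ} :
    (x : UnitAddCircle) = y ↔ ∃ m : ℤ, x + m = y := by
  rw [eq_comm, ← sub_eq_zero, ← AddCircle.coe_sub, AddCircle.coe_eq_zero_iff]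
  simp only [zsmul_eq_mul, mul_one, eq_sub_iff_add_eq, add_comm]

theorem coe_add_intCast (x : ℝ) (m : ℤ) : ((x + m : ℝ) : UnitAddCircle) = x :=
  (coe_eq_coe_iff_exists_add_intCast.2 ⟨m, rfl⟩).symm

theorem nsmul_coe (n : ℕ) (x : ℝ) :
    n • (x : UnitAddCircle) = ((n * x : ℝ) : UnitAddCircle) := by
  rw [← nsmul_eq_mul, AddCircle.coe_nsmul]

theorem zsmul_coe (n : ℤ) (x : ℝ) :
    n • (x : UnitAddCircle) = ((n * x : ℝ) : UnitAddCircle) := by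
  rw [← zsmul_eq_mul, AddCircle.coe_zsmul]

theorem coe_mem_cIoo_iff {u v : ℝ} (huv : u ≤ v) (hvu : v < u + 1) (z : ℝ) :
    (z : UnitAddCircle) ∈ Set.cIoo (u : UnitAddCircle) (v : UnitAddCircle) ↔
      ∃ m : ℤ, z + m ∈ Set.Ioo u v := by
  have hmod : (z : UnitAddCircle) ∈ Set.cIoo (u : UnitAddCircle) (v : UnitAddCircle) ↔
      toIocMod one_pos u z < v := by
    change sbtw (u : UnitAddCircle) (z : UnitAddCircle) (v : UnitAddCircle) ↔ _
    rw [sbtw_iff_not_btw, btw_cyclic, QuotientAddGroup.btw_coe_iff,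
      (toIcoMod_eq_self Fact.out).2 ⟨huv, hvu⟩, not_le]
  rw [hmod]
  constructor
  · intro h
    refine ⟨-toIocDiv one_pos u z, ?_⟩
    have hz : z + (-toIocDiv one_pos u z : ℤ) = toIocMod one_pos u z := by
      simp [toIocMod, sub_eq_add_neg]
    exact hz ▸ ⟨left_lt_toIocMod _ _ _, h⟩
  · rintro ⟨m, hm⟩
    have hz : toIocMod one_pos u z = z + m :=
      (toIocMod_eq_iff _).2 ⟨⟨hm.1, by linarith [hm.2]⟩, -m, by simp⟩
    exact hz ▸ hm.2

theorem exists_coe_eq_and_coe_eq (p q : UnitAddCircle) :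
    ∃ u v : ℝ, (u : UnitAddCircle) = p ∧ (v : UnitAddCircle) = q ∧ u ≤ v ∧ v < u + 1 := by
  obtain ⟨u, rfl⟩ := QuotientAddGroup.mk_surjective p
  obtain ⟨v, rfl⟩ := QuotientAddGroup.mk_surjective q
  refine ⟨u, u + Int.fract (v - u), rfl, ?_, by linarith [Int.fract_nonneg (v - u)],
    by linarith [Int.fract_lt_one (v - u)]⟩
  exact coe_eq_coe_iff_exists_add_intCast.2 ⟨⌊v - u⌋, by linarith [Int.fract_add_floor (v - u)]⟩

theorem neg_mem_cIoo_neg_iff {p q z : UnitAddCircle} :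
    -z ∈ Set.cIoo (-q) (-p) ↔ z ∈ Set.cIoo p q := by
  obtain ⟨u, v, rfl, rfl, huv, hvu⟩ := exists_coe_eq_and_coe_eq p q
  obtain ⟨z, rfl⟩ := QuotientAddGroup.mk_surjective z
  rw [← AddCircle.coe_neg, ← AddCircle.coe_neg, ← QuotientAddGroup.mk_neg,
    coe_mem_cIoo_iff (by linarith) (by linarith), coe_mem_cIoo_iff huv hvu]
  refine (Equiv.neg ℤ).exists_congr fun m => ?_
  rw [Equiv.neg_apply, Int.cast_neg, ← Set.neg_mem_Ioo_iff, neg_add, neg_neg]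

theorem add_mem_cIoo_add_iff {p q z w : UnitAddCircle} :
    z + w ∈ Set.cIoo (p + w) (q + w) ↔ z ∈ Set.cIoo p q := by
  obtain ⟨u, v, rfl, rfl, huv, hvu⟩ := exists_coe_eq_and_coe_eq p q
  obtain ⟨z, rfl⟩ := QuotientAddGroup.mk_surjective z
  obtain ⟨w, rfl⟩ := QuotientAddGroup.mk_surjective w
  rw [← AddCircle.coe_add, ← AddCircle.coe_add, ← QuotientAddGroup.mk_add,
    coe_mem_cIoo_iff (by linarith) (by linarith), coe_mem_cIoo_iff huv hvu]
  simp only [add_right_comm _ w, Set.mem_Ioo, add_lt_add_iff_right]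

theorem arcLength_coe (u v : ℝ) :
    arcLength (u : UnitAddCircle) (v : UnitAddCircle) = Int.fract (v - u) := by
  rw [arcLength, ← AddCircle.coe_sub, AddCircle.coe_equivIco_mk_apply]
  simp

theorem arcLength_coe_of_le {u v : ℝ} (huv : u ≤ v) (hvu : v < u + 1) :
    arcLength (u : UnitAddCircle) (v : UnitAddCircle) = v - u := by
  rw [arcLength_coe, Int.fract_eq_self]
  exact ⟨by linarith, by linarith⟩

theorem arcLength_neg_neg (p q : UnitAddCircle) : arcLength (-p) (-q) = arcLength q p := by
  rw [arcLength, arcLength]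
  congr 2
  abel

theorem leftTime_eq_rightTime_neg (α : UnitAddCircle) (n : ℕ) :
    leftTime α n = rightTime (-α) n := by
  simp only [leftTime, rightTime, smul_neg, ← neg_mem_cIoo_neg_iff (q := 0), neg_zero]

theorem leftGap_eq_rightGap_neg (α : UnitAddCircle) (n : ℕ) :
    leftGap α n = rightGap (-α) n := by
  rw [leftGap, rightGap, leftTime_eq_rightTime_neg, smul_neg, ← neg_zero, arcLength_neg_neg,
    neg_zero]

theorem rotateSet_rotateSet (α : UnitAddCircle) (m n : ℤ) (A : Set UnitAddCircle) :
    rotateSet α m (rotateSet α n A) = rotateSet α (n + m) A := by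
  simp only [rotateSet, Set.image_image, add_zsmul, add_assoc]

theorem rotateSet_cIoo (α p q : UnitAddCircle) (k : ℤ) :
    rotateSet α k (Set.cIoo p q) = Set.cIoo (p + k • α) (q + k • α) := by
  ext z
  rw [rotateSet, Set.image_add_right, Set.mem_preimage, ← add_mem_cIoo_add_iff (w := k • α),
    neg_add_cancel_right]

end Circle

/-! ### Neighbours of `0` and characteristic times -/

/-- The points `rτ` and `sτ` are, modulo `1`, the left and the right neighbour of `0`, at distances
`a` and `b`, in each of the orbit segments `0, τ, …, nτ` with `max r s ≤ n < r + s`. -/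
structure IsNeighbourPair (τ : ℝ) (r s : ℕ) (a b : ℝ) : Prop where
  left_time_pos : 0 < r
  right_time_pos : 0 < s
  left_gap_pos : 0 < a
  right_gap_pos : 0 < b
  exists_left : ∃ p : ℤ, r * τ + p = -a
  exists_right : ∃ q : ℤ, s * τ + q = b
  eq_zero_of_mem : ∀ j < r + s, ∀ m : ℤ, j * τ + m ∈ Set.Ioo (-a) b → j = 0

/-- The arithmetic condition on the pair of neighbours of `0` at a time `N` which makes `N - 1` a
characteristic time: the gaps are comparable, and the neighbour across the shorter gap is not
reached much later than the other one. -/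
def IsBalanced (r s : ℕ) (a b : ℝ) : Prop :=
  (a < b ∧ b ≤ 2 * a ∧ r ≤ 2 * s) ∨ (b < a ∧ a ≤ 2 * b ∧ s ≤ 2 * r)

theorem IsBalanced.symm {r s : ℕ} {a b : ℝ} (h : IsBalanced r s a b) : IsBalanced s r b a :=
  Or.symm h

theorem IsBalanced.right_gap_le {r s : ℕ} {a b : ℝ} (h : IsBalanced r s a b) :
    b ≤ 2 * min a b := by
  rw [mul_min_of_nonneg _ _ zero_le_two, le_min_iff]
  rcases h with ⟨hab, hba, _⟩ | ⟨hba, hab, _⟩ <;> constructor <;> linarith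

namespace IsNeighbourPair

variable {τ : ℝ} {r s n : ℕ} {a b : ℝ}

theorem neg (h : IsNeighbourPair τ r s a b) : IsNeighbourPair (-τ) s r b a where
  left_time_pos := h.right_time_pos
  right_time_pos := h.left_time_pos
  left_gap_pos := h.right_gap_pos
  right_gap_pos := h.left_gap_pos
  exists_left := by
    obtain ⟨q, hq⟩ := h.exists_right
    exact ⟨-q, by push_cast; linarith⟩
  exists_right := by
    obtain ⟨p, hp⟩ := h.exists_left
    exact ⟨-p, by push_cast; linarith⟩
  eq_zero_of_mem j hj m hm := h.eq_zero_of_mem j (by omega) (-m) (by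
    push_cast
    exact ⟨by linarith [hm.2], by linarith [hm.1]⟩)

theorem one_one (hτ : Irrational τ) : IsNeighbourPair τ 1 1 (1 - Int.fract τ) (Int.fract τ) where
  left_time_pos := one_pos
  right_time_pos := one_pos
  left_gap_pos := sub_pos.2 (Int.fract_lt_one τ)
  right_gap_pos := Int.fract_pos.2 (hτ.ne_int ⌊τ⌋)
  exists_left := ⟨-⌊τ⌋ - 1, by push_cast; linarith [Int.fract_add_floor τ]⟩
  exists_right := ⟨-⌊τ⌋, by push_cast; linarith [Int.fract_add_floor τ]⟩
  eq_zero_of_mem j hj m hm := by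
    by_contra hj0
    obtain rfl : j = 1 := by omega
    have hfloor := Int.fract_add_floor τ
    have hlt : ((⌊τ⌋ + m : ℤ) : ℝ) < (0 : ℤ) := by push_cast at hm ⊢; linarith [hm.2]
    have hgt : ((-1 : ℤ) : ℝ) < (⌊τ⌋ + m : ℤ) := by push_cast at hm ⊢; linarith [hm.1]
    rw [Int.cast_lt] at hlt hgt
    omega

theorem step (h : IsNeighbourPair τ r s a b) (hab : a < b) :
    IsNeighbourPair τ r (s + r) a (b - a) where
  left_time_pos := h.left_time_pos
  right_time_pos := Nat.add_pos_left h.right_time_pos r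
  left_gap_pos := h.left_gap_pos
  right_gap_pos := sub_pos.2 hab
  exists_left := h.exists_left
  exists_right := by
    obtain ⟨p, hp⟩ := h.exists_left
    obtain ⟨q, hq⟩ := h.exists_right
    exact ⟨q + p, by push_cast; linarith⟩
  eq_zero_of_mem j hj m hm := by
    have ha := h.left_gap_pos
    rcases lt_or_ge j (r + s) with hlt | hge
    · exact h.eq_zero_of_mem j hlt m ⟨hm.1, by linarith [hm.2]⟩
    · obtain ⟨p, hp⟩ := h.exists_left
      have hs := h.right_time_pos
      have hjr := h.eq_zero_of_mem (j - r) (by omega) (m - p) (by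
        rw [Nat.cast_sub (by omega)]
        push_cast
        exact ⟨by linarith [hm.1], by linarith [hm.2]⟩)
      omega

theorem steps (h : IsNeighbourPair τ r s a b) (k : ℕ) (hk : k * a < b) :
    IsNeighbourPair τ r (s + k * r) a (b - k * a) := by
  induction k with
  | zero => simpa using h
  | succ k ih =>
    have ha := h.left_gap_pos
    push_cast at hk ⊢
    convert (ih (by linarith)).step (by linarith) using 1 <;> ring

theorem right_gap_ne (h : IsNeighbourPair τ r s a b) (hτ : Irrational τ) (k : ℕ) :
    b ≠ k * a := by
  intro hb
  obtain ⟨p, hp⟩ := h.exists_left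
  obtain ⟨q, hq⟩ := h.exists_right
  have hs := h.right_time_pos
  refine (hτ.natCast_mul (m := s + k * r) (by positivity)).ne_int (-(q + k * p)) ?_
  push_cast
  linear_combination hq + k * hp + hb

theorem gap_ne (h : IsNeighbourPair τ r s a b) (hτ : Irrational τ) : a ≠ b := by
  simpa using (h.right_gap_ne hτ 1).symm

theorem exists_le_le_lt_add (hτ : Irrational τ) (hn : 1 ≤ n) :
    ∃ r s a b, IsNeighbourPair τ r s a b ∧ r ≤ n ∧ s ≤ n ∧ n < r + s := by
  induction n, hn using Nat.le_induction with
  | base => exact ⟨1, 1, _, _, one_one hτ, le_rfl, le_rfl, one_lt_two⟩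
  | succ n _ ih =>
    obtain ⟨r, s, a, b, h, hrn, hsn, hn⟩ := ih
    rcases lt_or_ge (n + 1) (r + s) with hlt | hge
    · exact ⟨r, s, a, b, h, by omega, by omega, hlt⟩
    rcases (h.gap_ne hτ).lt_or_gt with hab | hba
    · exact ⟨r, s + r, a, b - a, h.step hab, by omega, by omega,
        by linarith [h.left_time_pos]⟩
    · have hneg := (h.neg.step hba).neg
      rw [neg_neg] at hneg
      exact ⟨r + s, s, a - b, b, hneg, by omega, by omega,
        by linarith [h.right_time_pos]⟩

theorem gap_add_gap_le_one (h : IsNeighbourPair τ r s a b) : a + b ≤ 1 := by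
  by_contra! hlt
  obtain ⟨p, hp⟩ := h.exists_left
  refine h.left_time_pos.ne' (h.eq_zero_of_mem r (Nat.lt_add_of_pos_right h.right_time_pos)
    (p + 1) ?_)
  push_cast
  exact ⟨by linarith, by linarith⟩

theorem right_gap_lt_one (h : IsNeighbourPair τ r s a b) : b < 1 := by
  linarith [h.gap_add_gap_le_one, h.left_gap_pos]

theorem eq_of_add_intCast_eq (h : IsNeighbourPair τ r s a b) {j k : ℕ} (hj : j < r + s)
    (hk : k < r + s) {m l : ℤ} (hjk : j * τ + m = k * τ + l) : j = k := by
  wlog hle : k ≤ j generalizing j k m l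
  · exact (this hk hj hjk.symm (by omega)).symm
  have hsub := h.eq_zero_of_mem (j - k) (by omega) (m - l) (by
    rw [Nat.cast_sub hle]
    push_cast
    constructor <;> linarith [h.left_gap_pos, h.right_gap_pos])
  omega

theorem gap_add_gap_lt_one (h : IsNeighbourPair τ r s a b) (hr : 1 < r) : a + b < 1 := by
  refine h.gap_add_gap_le_one.lt_of_ne fun hab => ?_
  obtain ⟨p, hp⟩ := h.exists_left
  have hfract := Int.fract_add_floor (τ + a)
  rcases (Int.fract_nonneg (τ + a)).eq_or_lt with hzero | hpos
  · refine hr.ne (h.eq_of_add_intCast_eq (j := 1) (m := -⌊τ + a⌋) (l := p) (by omega)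
      (by linarith [h.right_time_pos]) ?_)
    push_cast
    linarith
  · refine one_ne_zero (h.eq_zero_of_mem 1 (by omega) (-⌊τ + a⌋) ?_)
    push_cast
    exact ⟨by linarith, by linarith [Int.fract_lt_one (τ + a)]⟩

theorem coe_left (h : IsNeighbourPair τ r s a b) :
    r • (τ : UnitAddCircle) = ((-a : ℝ) : UnitAddCircle) :=
  (nsmul_coe r τ).trans (coe_eq_coe_iff_exists_add_intCast.2 h.exists_left)

theorem coe_right (h : IsNeighbourPair τ r s a b) :
    s • (τ : UnitAddCircle) = ((b : ℝ) : UnitAddCircle) :=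
  (nsmul_coe s τ).trans (coe_eq_coe_iff_exists_add_intCast.2 h.exists_right)

theorem nsmul_notMem_cIoo (h : IsNeighbourPair τ r s a b) {j : ℕ} (hj : j < r + s) :
    j • (τ : UnitAddCircle) ∉ Set.cIoo 0 (s • (τ : UnitAddCircle)) := by
  rw [h.coe_right, ← AddCircle.coe_zero, nsmul_coe,
    coe_mem_cIoo_iff h.right_gap_pos.le (by linarith [h.right_gap_lt_one])]
  rintro ⟨m, hm⟩
  obtain rfl := h.eq_zero_of_mem j hj m ⟨by linarith [hm.1, h.left_gap_pos], hm.2⟩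
  rw [Nat.cast_zero, zero_mul, zero_add] at hm
  have hm0 : 0 < m := by exact_mod_cast hm.1
  have hm1 : m < 1 := by exact_mod_cast hm.2.trans h.right_gap_lt_one
  omega

theorem right_mem_cIoo (h : IsNeighbourPair τ r s a b) {t : ℕ} (ht : t < r + s) (ht0 : t ≠ 0)
    (hts : t ≠ s) : s • (τ : UnitAddCircle) ∈ Set.cIoo 0 (t • (τ : UnitAddCircle)) := by
  have hfract := Int.fract_add_floor (t * τ)
  have hcoe : t • (τ : UnitAddCircle) = (Int.fract (t * τ) : ℝ) :=
    (nsmul_coe t τ).trans (coe_eq_coe_iff_exists_add_intCast.2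
      ⟨-⌊t * τ⌋, by push_cast; linarith⟩)
  have hb : b < Int.fract (t * τ) := by
    by_contra! hle
    rcases hle.lt_or_eq with hlt | heq
    · refine ht0 (h.eq_zero_of_mem t ht (-⌊t * τ⌋) ?_)
      push_cast
      exact ⟨by linarith [h.left_gap_pos, Int.fract_nonneg (t * τ)], by linarith⟩
    · obtain ⟨q, hq⟩ := h.exists_right
      refine hts (h.eq_of_add_intCast_eq ht (by linarith [h.left_time_pos])
        (m := -⌊t * τ⌋) (l := q) ?_)
      push_cast
      linarith
  rw [h.coe_right, hcoe, ← AddCircle.coe_zero, coe_mem_cIoo_iff (Int.fract_nonneg _)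
    (by linarith [Int.fract_lt_one (t * τ)])]
  exact ⟨0, by rw [Int.cast_zero, add_zero]; exact ⟨h.right_gap_pos, hb⟩⟩

theorem rightTime_eq (h : IsNeighbourPair τ r s a b) (hs : s ≤ n) (hn : n < r + s) :
    rightTime (τ : UnitAddCircle) n = s := by
  suffices hset : {t : ℕ | 1 ≤ t ∧ t ≤ n ∧
      ∀ j : ℕ, j ≤ n → j • (τ : UnitAddCircle) ∉ Set.cIoo 0 (t • (τ : UnitAddCircle))} = {s} by
    rw [rightTime, hset, csInf_singleton]
  refine Set.eq_singleton_iff_unique_mem.2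
    ⟨⟨h.right_time_pos, hs, fun j hj => h.nsmul_notMem_cIoo (hj.trans_lt hn)⟩, ?_⟩
  rintro t ⟨ht, htn, hts⟩
  by_contra hne
  exact hts s hs (h.right_mem_cIoo (htn.trans_lt hn) (by omega) hne)

theorem rightGap_eq (h : IsNeighbourPair τ r s a b) (hs : s ≤ n) (hn : n < r + s) :
    rightGap (τ : UnitAddCircle) n = b := by
  rw [rightGap, h.rightTime_eq hs hn, h.coe_right, ← AddCircle.coe_zero,
    arcLength_coe_of_le h.right_gap_pos.le (by linarith [h.right_gap_lt_one]), sub_zero]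

theorem leftTime_eq (h : IsNeighbourPair τ r s a b) (hr : r ≤ n) (hn : n < r + s) :
    leftTime (τ : UnitAddCircle) n = r := by
  rw [leftTime_eq_rightTime_neg, ← AddCircle.coe_neg, h.neg.rightTime_eq hr (add_comm r s ▸ hn)]

theorem leftGap_eq (h : IsNeighbourPair τ r s a b) (hr : r ≤ n) (hn : n < r + s) :
    leftGap (τ : UnitAddCircle) n = a := by
  rw [leftGap_eq_rightGap_neg, ← AddCircle.coe_neg, h.neg.rightGap_eq hr (add_comm r s ▸ hn)]

theorem isPreCharacteristic_iff (h : IsNeighbourPair τ r s a b) (hn : r + s = n + 1) :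
    IsPreCharacteristic (τ : UnitAddCircle) n ↔ IsBalanced r s a b := by
  have ha := h.left_gap_pos
  have hb := h.right_gap_pos
  have hr : r ≤ n := by linarith [h.right_time_pos]
  have hs : s ≤ n := by linarith [h.left_time_pos]
  rw [IsPreCharacteristic, IsBeforeClosestReturn, h.leftTime_eq hr (by omega),
    h.rightTime_eq hs (by omega), h.leftGap_eq hr (by omega), h.rightGap_eq hs (by omega),
    IsBalanced, Set.mem_Icc, le_div_iff₀ hb, div_le_iff₀ hb]
  constructor
  · rintro ⟨⟨-, hba, hab⟩, ⟨hlt, htime⟩ | ⟨hlt, htime⟩⟩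
    · exact Or.inl ⟨hlt, by linarith, htime⟩
    · exact Or.inr ⟨hlt, hab, htime⟩
  · rintro (⟨hlt, hba, htime⟩ | ⟨hlt, hab, htime⟩)
    · exact ⟨⟨hn, by linarith, by linarith⟩, Or.inl ⟨hlt, htime⟩⟩
    · exact ⟨⟨hn, by linarith, hab⟩, Or.inr ⟨hlt, htime⟩⟩

theorem exists_steps_gap_le (h : IsNeighbourPair τ r s a b) (hab : a < b) :
    ∃ k : ℕ, ∃ b', IsNeighbourPair τ r (s + k * r) a b' ∧ a < b' ∧ b' ≤ 2 * a := by
  have ha := h.left_gap_pos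
  obtain ⟨k, hk⟩ : ∃ k : ℕ, ⌈b / a⌉₊ = k + 2 :=
    Nat.exists_eq_add_of_le' (Nat.lt_ceil.2 (by rwa [Nat.cast_one, one_lt_div ha]))
  have hlt : ((k + 1 : ℕ) : ℝ) * a < b := by
    rw [← lt_div_iff₀ ha, ← Nat.lt_ceil, hk]
    exact Nat.lt_succ_self _
  have hle : b ≤ ((k + 2 : ℕ) : ℝ) * a := by
    rw [← div_le_iff₀ ha, ← hk]
    exact Nat.le_ceil _
  push_cast at hlt hle
  exact ⟨k, _, h.steps k (by linarith), by linarith, by linarith⟩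

theorem exists_isBalanced_of_lt (h : IsNeighbourPair τ r s a b) (hτ : Irrational τ)
    (hab : a < b) :
    ∃ r' s' a' b', IsNeighbourPair τ r' s' a' b' ∧ IsBalanced r' s' a' b' ∧ r + s ≤ r' + s' := by
  obtain ⟨k, b', h', hab', hba'⟩ := h.exists_steps_gap_le hab
  rcases le_or_gt r (2 * (s + k * r)) with hrs | hsr
  · exact ⟨_, _, _, _, h', Or.inl ⟨hab', hba', hrs⟩, by omega⟩
  -- The left neighbour is late, so one step more makes the times comparable and the left gap the
  -- longer one.
  have h'' := (h'.step hab').neg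
  have hlt : b' - a < a := by
    refine lt_of_le_of_ne (by linarith) fun heq => h'.right_gap_ne hτ 2 ?_
    push_cast
    linarith
  obtain ⟨l, a', hl, hba'', hab''⟩ := h''.exists_steps_gap_le hlt
  have hneg := hl.neg
  rw [neg_neg] at hneg
  refine ⟨_, _, _, _, hneg, Or.inr ⟨hba'', hab'', ?_⟩, ?_⟩ <;> omega

theorem exists_isBalanced_lt_add (hτ : Irrational τ) (hn : 1 ≤ n) :
    ∃ r s a b, IsNeighbourPair τ r s a b ∧ IsBalanced r s a b ∧ n < r + s := by
  obtain ⟨r, s, a, b, h, -, -, hrs⟩ := exists_le_le_lt_add hτ hn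
  rcases (h.gap_ne hτ).lt_or_gt with hab | hba
  · obtain ⟨r', s', a', b', h', hbal, hle⟩ := h.exists_isBalanced_of_lt hτ hab
    exact ⟨r', s', a', b', h', hbal, by omega⟩
  · obtain ⟨s', r', b', a', h', hbal, hle⟩ := h.neg.exists_isBalanced_of_lt hτ.neg hba
    have hneg := h'.neg
    rw [neg_neg] at hneg
    exact ⟨r', s', a', b', hneg, hbal.symm, by omega⟩

end IsNeighbourPair

theorem exists_isCharacteristicSequence {τ : ℝ} (hτ : Irrational τ) :
    ∃ k : ℕ → ℕ, IsCharacteristicSequence (τ : UnitAddCircle) k := by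
  have hfreq : ∃ᶠ n in Filter.atTop, IsPreCharacteristic (τ : UnitAddCircle) n := by
    refine Filter.frequently_atTop.2 fun n => ?_
    obtain ⟨r, s, a, b, h, hbal, hn⟩ := IsNeighbourPair.exists_isBalanced_lt_add hτ n.succ_pos
    exact ⟨r + s - 1, by omega, (h.isPreCharacteristic_iff (by omega)).2 hbal⟩
  obtain ⟨N, hN, hpre⟩ := Filter.extraction_of_frequently_atTop hfreq
  exact ⟨_, N, hN, hpre, fun _ => rfl⟩

theorem IsPreCharacteristic.exists_isNeighbourPair {τ : ℝ} {n : ℕ}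
    (h : IsPreCharacteristic (τ : UnitAddCircle) n) (hτ : Irrational τ) (hn : 1 ≤ n) :
    ∃ r s a b, IsNeighbourPair τ r s a b ∧ IsBalanced r s a b ∧ r + s = n + 1 := by
  obtain ⟨r, s, a, b, hrs, hr, hs, hlt⟩ := IsNeighbourPair.exists_le_le_lt_add hτ hn
  have hsum : r + s = n + 1 := by
    rw [← h.1.1, hrs.leftTime_eq hr hlt, hrs.rightTime_eq hs hlt]
  exact ⟨r, s, a, b, hrs, (hrs.isPreCharacteristic_iff hsum).1 h, hsum⟩

/-! ### Wandering times -/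

namespace IsNeighbourPair

variable {τ : ℝ} {r s : ℕ} {a b : ℝ}

theorem min_gap_le (h : IsNeighbourPair τ r s a b) : min a b ≤ 1 / (r + s) := by
  have hr := h.left_time_pos
  have hs := h.right_time_pos
  obtain ⟨k, hk, hkrs, hround⟩ := Real.exists_nat_abs_mul_sub_round_le τ
    (show 0 < r + s - 1 by omega)
  have hcast : ((r + s - 1 : ℕ) : ℝ) + 1 = r + s := by
    rw [Nat.cast_sub (by omega)]
    push_cast
    ring
  rw [hcast] at hround
  refine le_trans ?_ hround
  by_contra! hlt
  obtain ⟨ha, hb⟩ := lt_min_iff.1 hlt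
  refine hk.ne' (h.eq_zero_of_mem k (by omega) (-round (k * τ)) ?_)
  rw [Int.cast_neg, ← sub_eq_add_neg]
  exact ⟨(abs_lt.1 ha).1, (abs_lt.1 hb).2⟩

theorem exists_pos_forall_le_right_gap (hτ : Irrational τ) (q : ℕ) :
    ∃ ε > 0, ∀ r s a b, IsNeighbourPair τ r s a b → s ≤ q → ε ≤ b := by
  obtain ⟨ε, hfar, hε⟩ := (((hτ.eventually_forall_le_dist_cast_div_of_denom_le q).filter_mono
    nhdsWithin_le_nhds).and (self_mem_nhdsWithin (s := Set.Ioi (0 : ℝ)))).exists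
  refine ⟨ε, hε, fun r s a b h hsq => ?_⟩
  obtain ⟨p, hp⟩ := h.exists_right
  have hs : (1 : ℝ) ≤ s := by exact_mod_cast h.right_time_pos
  calc ε ≤ dist τ ((-p : ℤ) / s) := hfar s hsq (-p)
    _ = |b / s| := by
      rw [Real.dist_eq, ← hp]
      congr 1
      push_cast
      field_simp
      ring
    _ = b / s := abs_of_pos (div_pos h.right_gap_pos (by linarith))
    _ ≤ b := div_le_self h.right_gap_pos.le hs

theorem eventually_lt_right_time (hτ : Irrational τ) (q : ℕ) :
    ∀ᶠ n : ℕ in Filter.atTop, ∀ r s a b, IsNeighbourPair τ r s a b → IsBalanced r s a b →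
      n ≤ r + s → q < s := by
  obtain ⟨ε, hε, hgap⟩ := exists_pos_forall_le_right_gap hτ q
  filter_upwards [(tendsto_natCast_atTop_atTop (R := ℝ)).eventually_gt_atTop (2 / ε)]
    with n hn r s a b h hbal hnrs
  by_contra! hsq
  have hnrs' : (n : ℝ) ≤ r + s := by exact_mod_cast hnrs
  have hb : ε ≤ 2 / (r + s) := calc
    ε ≤ b := hgap r s a b h hsq
    _ ≤ 2 * min a b := hbal.right_gap_le
    _ ≤ 2 * (1 / (r + s)) := by linarith [h.min_gap_le]
    _ = 2 / (r + s) := mul_one_div _ _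
  have hrs : (0 : ℝ) < r + s := by linarith [div_pos two_pos hε]
  exact ((div_lt_comm₀ hε hrs).1 (hn.trans_le hnrs')).not_ge hb

theorem eventually_lt_min_time (hτ : Irrational τ) (q : ℕ) :
    ∀ᶠ n : ℕ in Filter.atTop, ∀ r s a b, IsNeighbourPair τ r s a b → IsBalanced r s a b →
      n ≤ r + s → q < min r s := by
  filter_upwards [eventually_lt_right_time hτ q, eventually_lt_right_time hτ.neg q]
    with n hright hleft r s a b h hbal hn
  exact lt_min (hleft s r b a h.neg hbal.symm (add_comm r s ▸ hn)) (hright r s a b h hbal hn)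

theorem gap_add_gap_le_abs (h : IsNeighbourPair τ r s a b) {d : ℤ} (hd : d ≠ 0) (hdr : |d| < r)
    (hds : |d| < s) (m : ℤ) : a + b ≤ |d * τ + m| := by
  wlog hpos : 0 < d generalizing d m
  · have hneg := this (neg_ne_zero.2 hd) (by rwa [abs_neg]) (by rwa [abs_neg]) (-m) (by omega)
    push_cast at hneg
    rwa [neg_mul, ← neg_add, abs_neg] at hneg
  lift d to ℕ using hpos.le
  rw [Nat.abs_cast, Nat.cast_lt] at hdr hds
  rw [Int.cast_natCast]
  by_contra! hlt
  obtain ⟨hgt, hlt⟩ := abs_lt.1 hlt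
  rcases le_or_gt (d * τ + m) (-a) with hle | hgt'
  · obtain ⟨p, hp⟩ := h.exists_left
    have := h.eq_zero_of_mem (r - d) (by omega) (p - m) (by
      rw [Nat.cast_sub hdr.le]
      push_cast
      exact ⟨by linarith [h.left_gap_pos], by linarith⟩)
    omega
  rcases le_or_gt b (d * τ + m) with hge | hlt'
  · obtain ⟨q, hq⟩ := h.exists_right
    have := h.eq_zero_of_mem (s - d) (by omega) (q - m) (by
      rw [Nat.cast_sub hds.le]
      push_cast
      exact ⟨by linarith, by linarith [h.right_gap_pos]⟩)
    omega
  · exact hd (by exact_mod_cast h.eq_zero_of_mem d (by omega) m ⟨hgt', hlt'⟩)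

theorem disjoint_rotateSet_cIoo (h : IsNeighbourPair τ r s a b) {i j : ℤ} (hij : i ≠ j)
    (hr : |i - j| < r) (hs : |i - j| < s) :
    Disjoint (rotateSet τ i (Set.cIoo (r • (τ : UnitAddCircle)) (s • (τ : UnitAddCircle))))
      (rotateSet τ j (Set.cIoo (r • (τ : UnitAddCircle)) (s • (τ : UnitAddCircle)))) := by
  have hd : 1 ≤ |i - j| := Int.one_le_abs (sub_ne_zero.2 hij)
  have hab := h.gap_add_gap_lt_one (by omega)
  have ha := h.left_gap_pos
  have hb := h.right_gap_pos
  have hmem : ∀ (k : ℤ) (z : ℝ), (z : UnitAddCircle) ∈ rotateSet τ k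
      (Set.cIoo (r • (τ : UnitAddCircle)) (s • (τ : UnitAddCircle))) ↔
        ∃ m : ℤ, z + m ∈ Set.Ioo (-a + k * τ) (b + k * τ) := fun k z => by
    rw [rotateSet_cIoo, h.coe_left, h.coe_right, zsmul_coe, ← AddCircle.coe_add,
      ← AddCircle.coe_add, coe_mem_cIoo_iff (by linarith) (by linarith)]
  rw [Set.disjoint_left]
  intro z hi hj
  obtain ⟨z, rfl⟩ := QuotientAddGroup.mk_surjective z
  obtain ⟨m, hm⟩ := (hmem i z).1 hi
  obtain ⟨l, hl⟩ := (hmem j z).1 hj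
  refine (h.gap_add_gap_le_abs (sub_ne_zero.2 hij) hr hs (l - m)).not_gt ?_
  push_cast
  exact abs_lt.2 ⟨by linarith [hm.2, hl.1], by linarith [hm.1, hl.2]⟩

theorem arcI_eq (h : IsNeighbourPair τ r s a b) (hr : 1 < r) (hs : 1 < s) :
    arcI (τ : UnitAddCircle) (r + s - 2) =
      Set.cIoo (r • (τ : UnitAddCircle)) (s • (τ : UnitAddCircle)) := by
  rw [arcI, h.leftTime_eq (by omega) (by omega), h.rightTime_eq (by omega) (by omega)]

theorem arcJ_eq (h : IsNeighbourPair τ r s a b) (hr : 1 < r) (hs : 1 < s) :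
    arcJ (τ : UnitAddCircle) (r + s - 2) = rotateSet τ (-2)
      (Set.cIoo (r • (τ : UnitAddCircle)) (s • (τ : UnitAddCircle))) := by
  rw [arcJ, h.leftTime_eq (by omega) (by omega), h.rightTime_eq (by omega) (by omega),
    rotateSet_cIoo, ← natCast_zsmul _ r, ← natCast_zsmul _ s, ← add_zsmul, ← add_zsmul]
  congr 2 <;> omega

theorem wandersFor (h : IsNeighbourPair τ r s a b) {w : ℕ} (hr : 2 * w + 2 < r)
    (hs : 2 * w + 2 < s) : WandersFor (τ : UnitAddCircle) (r + s - 2) w := by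
  rw [WandersFor, h.arcI_eq (by omega) (by omega), h.arcJ_eq (by omega) (by omega)]
  simp only [rotateSet_rotateSet]
  refine ⟨fun i j hi hj hij => ?_, fun i j hi hj hij => ?_, fun i j hi hj => ?_⟩ <;>
    refine h.disjoint_rotateSet_cIoo ?_ ?_ ?_ <;> grind

theorem lt_of_wandersFor (h : IsNeighbourPair τ r s a b) (hr : 1 < r) (hs : 1 < s) {w : ℕ}
    (hw : WandersFor (τ : UnitAddCircle) (r + s - 2) w) : w < r + s := by
  by_contra! hle
  have hab := h.gap_add_gap_lt_one hr
  have ha := h.left_gap_pos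
  have hb := h.right_gap_pos
  have hdisj := hw.1 0 (r + s) (Nat.zero_le w) hle (by omega)
  rw [h.arcI_eq hr hs, h.coe_left, h.coe_right] at hdisj
  have hsum : (r + s) • (τ : UnitAddCircle) = ((b - a : ℝ) : UnitAddCircle) := by
    rw [add_smul, h.coe_left, h.coe_right, ← AddCircle.coe_add, neg_add_eq_sub]
  refine Set.disjoint_left.1 hdisj ⟨(r + s) • (τ : UnitAddCircle), ?_, ?_⟩
    ⟨0, ?_, (zero_add _).trans (natCast_zsmul _ _)⟩
  · rw [hsum, coe_mem_cIoo_iff (by linarith) (by linarith)]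
    exact ⟨0, by push_cast; constructor <;> linarith⟩
  · simp only [Nat.cast_zero, zero_zsmul, add_zero]
  · rw [← AddCircle.coe_zero, coe_mem_cIoo_iff (by linarith) (by linarith)]
    exact ⟨0, by push_cast; constructor <;> linarith⟩

theorem min_time_le_wanderingTime (h : IsNeighbourPair τ r s a b) :
    min r s ≤ 2 * wanderingTime (τ : UnitAddCircle) (r + s - 2) + 4 := by
  by_contra! hlt
  have hle : (min r s - 3) / 2 ≤ wanderingTime (τ : UnitAddCircle) (r + s - 2) :=
    le_csSup ⟨r + s, fun w hw => (h.lt_of_wandersFor (by omega) (by omega) hw).le⟩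
      (h.wandersFor (by omega) (by omega))
  omega

end IsNeighbourPair

/-! ### Subexponential growth of derivatives -/

section UniformContinuity

theorem exists_dist_le_add_mul_dist {X Y : Type*} [PseudoMetricSpace X]
    [PseudoMetricSpace Y] {φ : X → Y} (hφ : UniformContinuous φ)
    (hbdd : Bornology.IsBounded (Set.range φ)) {ε : ℝ} (hε : 0 < ε) :
    ∃ L, 0 ≤ L ∧ ∀ x y, dist (φ x) (φ y) ≤ ε + L * dist x y := by
  obtain ⟨δ, hδ, hclose⟩ := Metric.uniformContinuous_iff.1 hφ ε hε
  obtain ⟨C, hC⟩ := Metric.isBounded_range_iff.1 hbdd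
  rcases isEmpty_or_nonempty X with hX | ⟨⟨x₀⟩⟩
  · exact ⟨0, le_rfl, fun x => hX.elim x⟩
  have hC₀ : 0 ≤ C := dist_nonneg.trans (hC x₀ x₀)
  refine ⟨C / δ, by positivity, fun x y => ?_⟩
  rcases lt_or_ge (dist x y) δ with hlt | hge
  · exact (hclose hlt).le.trans (le_add_of_nonneg_right (by positivity))
  · calc dist (φ x) (φ y) ≤ C := hC x y
      _ = C / δ * δ := (div_mul_cancel₀ C hδ.ne').symm
      _ ≤ C / δ * dist x y := by gcongr
      _ ≤ ε + C / δ * dist x y := le_add_of_nonneg_left hε.le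

theorem uniformContinuous_of_periodic {Y : Type*} [UniformSpace Y] {φ : ℝ → Y} {T : ℝ}
    [Fact (0 < T)] (hφ : Continuous φ) (hper : Function.Periodic φ T) : UniformContinuous φ := by
  have hlift : UniformContinuous (hper.lift : AddCircle T → Y) :=
    CompactSpace.uniformContinuous_of_continuous (hφ.quotient_lift _)
  have hmk : UniformContinuous ((↑) : ℝ → AddCircle T) :=
    uniformContinuous_addMonoidHom_of_continuous
      (f := QuotientAddGroup.mk' (AddSubgroup.zmultiples T)) (AddCircle.continuous_mk' T)
  exact hlift.comp hmk

end UniformContinuity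

section DisjointArcs

open MeasureTheory

variable {T : ℝ}

theorem measurableSet_coe_image_Ioo (u v : ℝ) :
    MeasurableSet (((↑) : ℝ → AddCircle T) '' Set.Ioo u v) :=
  (QuotientAddGroup.isOpenMap_coe _ isOpen_Ioo).measurableSet

variable [hT : Fact (0 < T)]

theorem ofReal_sub_le_volume_coe_image_Ioo {u v : ℝ} (hvu : v ≤ u + T) :
    ENNReal.ofReal (v - u) ≤ volume (((↑) : ℝ → AddCircle T) '' Set.Ioo u v) := by
  have hsub : Set.Ioo u v ⊆ Set.Ioc u (u + T) := fun y hy => ⟨hy.1, hy.2.le.trans hvu⟩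
  rw [← (AddCircle.measurePreserving_mk T u).measure_preimage
    (measurableSet_coe_image_Ioo u v).nullMeasurableSet, ← Real.volume_Ioo,
    ← Measure.restrict_eq_self volume hsub]
  exact measure_mono (Set.subset_preimage_image _ _)

theorem sum_sub_le_of_pairwiseDisjoint_arcs {ι : Type*} {s : Finset ι} {u v : ι → ℝ}
    (hvu : ∀ i ∈ s, v i ≤ u i + T)
    (hdisj : (s : Set ι).PairwiseDisjoint fun i =>
      ((↑) : ℝ → AddCircle T) '' Set.Ioo (u i) (v i)) :
    ∑ i ∈ s, (v i - u i) ≤ T := by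
  have hsum : ∑ i ∈ s, ENNReal.ofReal (v i - u i) ≤ ENNReal.ofReal T := calc
    _ ≤ ∑ i ∈ s, volume (((↑) : ℝ → AddCircle T) '' Set.Ioo (u i) (v i)) :=
      Finset.sum_le_sum fun i hi => ofReal_sub_le_volume_coe_image_Ioo (hvu i hi)
    _ = volume (⋃ i ∈ s, ((↑) : ℝ → AddCircle T) '' Set.Ioo (u i) (v i)) :=
      (measure_biUnion_finset hdisj fun i _ => measurableSet_coe_image_Ioo _ _).symm
    _ ≤ volume (Set.univ : Set (AddCircle T)) := measure_mono (Set.subset_univ _)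
    _ = ENNReal.ofReal T := AddCircle.measure_univ T
  calc ∑ i ∈ s, (v i - u i) ≤ ∑ i ∈ s, (ENNReal.ofReal (v i - u i)).toReal :=
        Finset.sum_le_sum fun i _ => by
          rw [ENNReal.toReal_ofReal']; exact le_max_left _ _
    _ = (∑ i ∈ s, ENNReal.ofReal (v i - u i)).toReal :=
        (ENNReal.toReal_sum fun _ _ => ENNReal.ofReal_ne_top).symm
    _ ≤ T := ENNReal.toReal_le_of_le_ofReal hT.out.le hsum

end DisjointArcs

section DerivIterate

theorem hasDerivAt_iterate_prod {𝕜 : Type*} [NontriviallyNormedField 𝕜] {f : 𝕜 → 𝕜}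
    (hf : Differentiable 𝕜 f) (n : ℕ) (x : 𝕜) :
    HasDerivAt f^[n] (∏ j ∈ Finset.range n, deriv f (f^[j] x)) x := by
  induction n with
  | zero => simpa using hasDerivAt_id x
  | succ n ih =>
    rw [Finset.prod_range_succ, mul_comm, Function.iterate_succ']
    exact (hf _).hasDerivAt.comp x ih

theorem deriv_iterate_eq_exp_sum_log {f : ℝ → ℝ} (hf : Differentiable ℝ f)
    (hpos : ∀ x, 0 < deriv f x) (n : ℕ) (x : ℝ) :
    deriv f^[n] x = Real.exp (∑ j ∈ Finset.range n, Real.log (deriv f (f^[j] x))) := by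
  rw [(hasDerivAt_iterate_prod hf n x).deriv, Real.exp_sum]
  exact Finset.prod_congr rfl fun j _ => (Real.exp_log (hpos _)).symm

end DerivIterate

section Growth

open Topology

variable {f : CircleDeg1Lift}

theorem exists_pos_forall_le_norm_pow_sub (hf : Continuous f)
    (hτ : Irrational f.translationNumber) {j : ℕ} (hj : j ≠ 0) :
    ∃ c > 0, ∀ x : ℝ, c ≤ ‖(((f ^ j) x - x : ℝ) : UnitAddCircle)‖ := by
  have hper : Function.Periodic (fun x => ‖(((f ^ j) x - x : ℝ) : UnitAddCircle)‖) 1 := fun x => by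
    simp only [CircleDeg1Lift.map_add_one, add_sub_add_right_eq_sub]
  have hcont : Continuous fun x => ‖(((f ^ j) x - x : ℝ) : UnitAddCircle)‖ :=
    ((AddCircle.continuous_mk' 1).comp
      ((CircleDeg1Lift.continuous_pow f hf j).sub continuous_id)).norm
  obtain ⟨_, ⟨x₀, rfl⟩, hmin⟩ :=
    (hper.compact_of_continuous one_ne_zero hcont).exists_isLeast (Set.range_nonempty _)
  refine ⟨_, norm_pos_iff.2 fun hzero => ?_, fun x => hmin ⟨x, rfl⟩⟩
  obtain ⟨m, hm⟩ := (AddCircle.coe_eq_zero_iff 1).1 hzero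
  rw [zsmul_eq_mul, mul_one, eq_sub_iff_add_eq'] at hm
  have htrans := (f ^ j).translationNumber_of_eq_add_int hm.symm
  rw [CircleDeg1Lift.translationNumber_pow] at htrans
  exact (hτ.natCast_mul hj).ne_int m htrans

theorem exists_forall_le_norm_pow_sub (hf : Continuous f)
    (hτ : Irrational f.translationNumber) (q : ℕ) :
    ∃ c ∈ Set.Ioc (0 : ℝ) 1, ∀ j ∈ Finset.Ico 1 q, ∀ x : ℝ,
      c ≤ ‖(((f ^ j) x - x : ℝ) : UnitAddCircle)‖ := by
  have hsmall : ∀ᶠ c in 𝓝[>] (0 : ℝ), ∀ j ∈ Finset.Ico 1 q, ∀ x : ℝ,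
      c ≤ ‖(((f ^ j) x - x : ℝ) : UnitAddCircle)‖ := by
    refine (Finset.eventually_all _).2 fun j hj => ?_
    obtain ⟨c, hc, hle⟩ := exists_pos_forall_le_norm_pow_sub hf hτ
      (Nat.one_le_iff_ne_zero.1 (Finset.mem_Ico.1 hj).1)
    filter_upwards [Ioc_mem_nhdsGT hc] with c' hc' x using hc'.2.trans (hle x)
  obtain ⟨c, hle, hc⟩ := (hsmall.and (Ioc_mem_nhdsGT one_pos)).exists
  exact ⟨c, hc, hle⟩

theorem pairwiseDisjoint_arcs_pow (hf : Continuous f) (hmono : StrictMono f) {q : ℕ} {c : ℝ}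
    (hc : 0 ≤ c)
    (hsep : ∀ j ∈ Finset.Ico 1 q, ∀ x : ℝ, c ≤ ‖(((f ^ j) x - x : ℝ) : UnitAddCircle)‖)
    (n : ℕ) (x : ℝ) :
    (Finset.Ico n (n + q) : Set ℕ).PairwiseDisjoint fun j =>
      ((↑) : ℝ → UnitAddCircle) '' Set.Ioo ((f ^ j) x) ((f ^ j) (x + c)) := by
  intro i hi j hj hij
  wlog hlt : i < j generalizing i j
  · exact (this hj hi hij.symm (by omega)).symm
  rw [Finset.coe_Ico, Set.mem_Ico] at hi hj
  rw [Function.onFun, Set.disjoint_left]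
  rintro _ ⟨y, hy, rfl⟩ ⟨z, hz, hzy⟩
  have hxc : x ≤ x + c := le_add_of_nonneg_right hc
  obtain ⟨y, hxy, rfl⟩ := intermediate_value_Ioo hxc
    (CircleDeg1Lift.continuous_pow f hf i).continuousOn hy
  obtain ⟨z, hxz, rfl⟩ := intermediate_value_Ioo hxc
    (CircleDeg1Lift.continuous_pow f hf j).continuousOn hz
  obtain ⟨m, hm⟩ := coe_eq_coe_iff_exists_add_intCast.1 hzy
  have hinj : Function.Injective (f ^ i) := by
    rw [CircleDeg1Lift.coe_pow]
    exact hmono.injective.iterate i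
  have hreturn : (f ^ (j - i)) z + m = y := hinj (by
    rw [CircleDeg1Lift.map_add_int, ← CircleDeg1Lift.mul_apply, ← pow_add,
      Nat.add_sub_cancel' hlt.le, hm])
  have hle := hsep (j - i) (Finset.mem_Ico.2 ⟨by omega, by omega⟩) z
  rw [← coe_add_intCast _ m, sub_add_eq_add_sub, hreturn] at hle
  refine (hle.trans (QuotientAddGroup.norm_mk_le_norm)).not_gt ?_
  exact abs_lt.2 ⟨by linarith [hxy.1, hxz.2], by linarith [hxy.2, hxz.1]⟩

theorem sum_pow_sub_le (hf : Continuous f) (hmono : StrictMono f) {q : ℕ} (hq : 0 < q) {c : ℝ}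
    (hc : c ∈ Set.Ioc (0 : ℝ) 1)
    (hsep : ∀ j ∈ Finset.Ico 1 q, ∀ x : ℝ, c ≤ ‖(((f ^ j) x - x : ℝ) : UnitAddCircle)‖)
    (n : ℕ) (x : ℝ) :
    ∑ j ∈ Finset.range n, ((f ^ j) (x + c) - (f ^ j) x) ≤ n / q + 1 := by
  have hblock (k : ℕ) :
      ∑ j ∈ Finset.Ico k (k + q), ((f ^ j) (x + c) - (f ^ j) x) ≤ 1 :=
    sum_sub_le_of_pairwiseDisjoint_arcs (fun j _ => by
      rw [← CircleDeg1Lift.map_add_one]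
      exact (f ^ j).monotone (by linarith [hc.2]))
      (pairwiseDisjoint_arcs_pow hf hmono hc.1.le hsep k x)
  induction n using Nat.strong_induction_on with
  | _ n ih =>
    rcases lt_or_ge n q with hlt | hge
    · calc _ ≤ ∑ j ∈ Finset.Ico 0 (0 + q), ((f ^ j) (x + c) - (f ^ j) x) :=
            Finset.sum_le_sum_of_subset_of_nonneg
              (by rw [Finset.range_eq_Ico]; exact Finset.Ico_subset_Ico_right (by omega))
              fun j _ _ => sub_nonneg.2 ((f ^ j).monotone (by linarith [hc.1]))
        _ ≤ 1 := hblock 0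
        _ ≤ n / q + 1 := le_add_of_nonneg_left (by positivity)
    · obtain ⟨k, rfl⟩ := Nat.exists_eq_add_of_le' hge
      rw [← Finset.sum_range_add_sum_Ico _ (Nat.le_add_right k q)]
      have hq' : (q : ℝ) ≠ 0 := by positivity
      push_cast
      rw [add_div, div_self hq']
      linarith [ih k (by omega), hblock k]

theorem exists_sum_pow_sub_le (hf : Continuous f) (hmono : StrictMono f)
    (hτ : Irrational f.translationNumber) {ε : ℝ} (hε : 0 < ε) :
    ∃ c ∈ Set.Ioc (0 : ℝ) 1, ∀ (n : ℕ) (x : ℝ),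
      ∑ j ∈ Finset.range n, ((f ^ j) (x + c) - (f ^ j) x) ≤ ε * n + 1 := by
  obtain ⟨q, hq⟩ := exists_nat_one_div_lt hε
  obtain ⟨c, hc, hsep⟩ := exists_forall_le_norm_pow_sub hf hτ (q + 1)
  refine ⟨c, hc, fun n x => (sum_pow_sub_le hf hmono q.succ_pos hc hsep n x).trans ?_⟩
  rw [div_eq_inv_mul, ← one_div]
  push_cast
  gcongr

theorem exists_sum_dist_pow_le (hf : Continuous f) (hmono : StrictMono f)
    (hτ : Irrational f.translationNumber) {Y : Type*} [PseudoMetricSpace Y] {φ : ℝ → Y}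
    (hφ : Continuous φ) (hper : Function.Periodic φ 1) {ε : ℝ} (hε : 0 < ε) :
    ∃ c ∈ Set.Ioc (0 : ℝ) 1, ∃ B, ∀ (n : ℕ) (x : ℝ), ∀ y ∈ Set.Icc x (x + c),
      ∑ j ∈ Finset.range n, dist (φ ((f ^ j) x)) (φ ((f ^ j) y)) ≤ ε * n + B := by
  obtain ⟨L, hL, hdist⟩ := exists_dist_le_add_mul_dist (uniformContinuous_of_periodic hφ hper)
    (hper.isBounded_of_continuous one_ne_zero hφ) (half_pos hε)
  obtain ⟨c, hc, hsum⟩ := exists_sum_pow_sub_le hf hmono hτ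
    (show 0 < ε / 2 / (L + 1) by positivity)
  refine ⟨c, hc, L, fun n x y hy => ?_⟩
  have hlength (j : ℕ) : dist ((f ^ j) x) ((f ^ j) y) ≤ (f ^ j) (x + c) - (f ^ j) x := by
    rw [dist_comm, Real.dist_eq, abs_of_nonneg (sub_nonneg.2 ((f ^ j).monotone hy.1))]
    exact sub_le_sub_right ((f ^ j).monotone hy.2) _
  calc ∑ j ∈ Finset.range n, dist (φ ((f ^ j) x)) (φ ((f ^ j) y))
      ≤ ∑ j ∈ Finset.range n, (ε / 2 + L * ((f ^ j) (x + c) - (f ^ j) x)) :=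
        Finset.sum_le_sum fun j _ => (hdist _ _).trans (by gcongr; exact hlength j)
    _ = ε / 2 * n + L * ∑ j ∈ Finset.range n, ((f ^ j) (x + c) - (f ^ j) x) := by
        rw [Finset.sum_add_distrib, ← Finset.mul_sum, Finset.sum_const, Finset.card_range,
          nsmul_eq_mul, mul_comm]
    _ ≤ ε / 2 * n + L * (ε / 2 / (L + 1) * n + 1) := by gcongr; exact hsum n x
    _ = ε / 2 * n + L / (L + 1) * (ε / 2 * n) + L := by ring
    _ ≤ ε / 2 * n + 1 * (ε / 2 * n) + L := by
        gcongr
        exact (div_le_one (by positivity)).2 (by linarith)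
    _ = ε * n + L := by ring

theorem periodic_deriv (f : CircleDeg1Lift) : Function.Periodic (deriv f) 1 := fun x => by
  rw [← deriv_comp_add_const]
  simp only [CircleDeg1Lift.map_add_one, deriv_add_const]

theorem exists_deriv_pow_le (hf : ContDiff ℝ 1 f) (hpos : ∀ x, 0 < deriv f x)
    (hτ : Irrational f.translationNumber) {ε : ℝ} (hε : 0 < ε) :
    ∃ C > 0, ∀ (n : ℕ) (x : ℝ), deriv (f ^ n : CircleDeg1Lift) x ≤ C * Real.exp (ε * n) := by
  have hdiff : Differentiable ℝ f := hf.differentiable one_ne_zero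
  obtain ⟨c, hc, B, hB⟩ := exists_sum_dist_pow_le hf.continuous (strictMono_of_deriv_pos hpos) hτ
    ((hf.continuous_deriv le_rfl).log fun x => (hpos x).ne')
    ((periodic_deriv f).comp Real.log) hε
  have hc₀ : 0 < c := hc.1
  refine ⟨Real.exp B / c, by positivity, fun n x => ?_⟩
  have hdiffn : Differentiable ℝ (f ^ n : CircleDeg1Lift) := by
    rw [CircleDeg1Lift.coe_pow]
    exact hdiff.iterate n
  obtain ⟨ξ, hξ, hslope⟩ := exists_deriv_eq_slope (f ^ n : CircleDeg1Lift)
    (show x < x + c by linarith) hdiffn.continuous.continuousOn hdiffn.differentiableOn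
  have hderivξ : deriv (f ^ n : CircleDeg1Lift) ξ ≤ 1 / c := by
    rw [hslope, add_sub_cancel_left]
    gcongr
    rw [sub_le_iff_le_add', ← CircleDeg1Lift.map_add_one]
    exact (f ^ n).monotone (by linarith [hc.2])
  have hdist := hB n x ξ (Set.Ioo_subset_Icc_self hξ)
  have hlog : ∑ j ∈ Finset.range n, Real.log (deriv f ((f ^ j) x)) -
      ∑ j ∈ Finset.range n, Real.log (deriv f ((f ^ j) ξ)) ≤ ε * n + B := by
    rw [← Finset.sum_sub_distrib]
    exact (Finset.sum_le_sum fun j _ => le_abs_self _).trans hdist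
  simp only [CircleDeg1Lift.coe_pow] at hderivξ hlog ⊢
  calc deriv f^[n] x = Real.exp (∑ j ∈ Finset.range n, Real.log (deriv f (f^[j] x))) :=
        deriv_iterate_eq_exp_sum_log hdiff hpos n x
    _ ≤ Real.exp (∑ j ∈ Finset.range n, Real.log (deriv f (f^[j] ξ)) + (ε * n + B)) := by
        gcongr
        linarith
    _ = deriv f^[n] ξ * (Real.exp (ε * n) * Real.exp B) := by
        rw [Real.exp_add, Real.exp_add, deriv_iterate_eq_exp_sum_log hdiff hpos]
    _ ≤ 1 / c * (Real.exp (ε * n) * Real.exp B) := by gcongr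
    _ = Real.exp B / c * Real.exp (ε * n) := by ring

end Growth

/-! ### Ratios of characteristic segments -/

section Lipschitz

theorem exists_abs_pow_sub_le {f : CircleDeg1Lift} (hf : ContDiff ℝ 1 f)
    (hpos : ∀ x, 0 < deriv f x) (hτ : Irrational f.translationNumber) {ε : ℝ} (hε : 0 < ε) :
    ∃ C > 0, ∀ (n : ℕ) (u v : ℝ),
      |(f ^ n) u - (f ^ n) v| ≤ C * Real.exp (ε * n) * |u - v| := by
  obtain ⟨C, hC, hderiv⟩ := exists_deriv_pow_le hf hpos hτ hε
  refine ⟨C, hC, fun n u v => ?_⟩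
  have hdiff : Differentiable ℝ (f ^ n : CircleDeg1Lift) := by
    rw [CircleDeg1Lift.coe_pow]
    exact (hf.differentiable one_ne_zero).iterate n
  refine convex_univ.norm_image_sub_le_of_norm_deriv_le (fun y _ => hdiff y) (fun y _ => ?_)
    (Set.mem_univ v) (Set.mem_univ u)
  rw [Real.norm_eq_abs, abs_of_nonneg (f ^ n).monotone.deriv_nonneg]
  exact hderiv n y

theorem deriv_pos_of_differentiable_inv {F : CircleDeg1Liftˣ}
    (hF : Differentiable ℝ (F : CircleDeg1Lift))
    (hF' : Differentiable ℝ ((F⁻¹ : CircleDeg1Liftˣ) : CircleDeg1Lift)) (x : ℝ) :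
    0 < deriv (F : CircleDeg1Lift) x := by
  have hcomp := (hF' ((F : CircleDeg1Lift) x)).hasDerivAt.comp x (hF x).hasDerivAt
  rw [show ((F⁻¹ : CircleDeg1Liftˣ) : CircleDeg1Lift) ∘ (F : CircleDeg1Lift) = (id : ℝ → ℝ) from
    funext (CircleDeg1Lift.units_inv_apply_apply F)] at hcomp
  have hprod := hcomp.unique (hasDerivAt_id x)
  exact (F : CircleDeg1Lift).monotone.deriv_nonneg.lt_of_ne'
    (right_ne_zero_of_mul (hprod ▸ one_ne_zero))

end Lipschitz

/-- The lift `F ^ j + m` of the `j`-th iterate of the circle homeomorphism with lift `F`; it plays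
the role of the translation by `j * τ + m`, with `τ` the translation number of `F`. -/
def iterLift (F : CircleDeg1Liftˣ) (j m : ℤ) (x : ℝ) : ℝ :=
  ((F ^ j : CircleDeg1Liftˣ) : CircleDeg1Lift) x + m

/-- The circle map with lift `F`. -/
def toCircleMap (F : CircleDeg1Lift) : UnitAddCircle → UnitAddCircle :=
  Function.Periodic.lift (f := fun t : ℝ => ((F t : ℝ) : UnitAddCircle)) (c := 1) fun t => by
    simp only [F.map_add_one, AddCircle.coe_add_period]

section IterLift

variable {F : CircleDeg1Liftˣ} {j m k l : ℤ}

theorem iterLift_comp (F : CircleDeg1Liftˣ) (j m k l : ℤ) (x : ℝ) :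
    iterLift F j m (iterLift F k l x) = iterLift F (j + k) (m + l) x := by
  simp only [iterLift, CircleDeg1Lift.map_add_int, zpow_add, Units.val_mul,
    CircleDeg1Lift.mul_apply, Int.cast_add]
  ring

theorem iterLift_zero (F : CircleDeg1Liftˣ) (x : ℝ) : iterLift F 0 0 x = x := by
  simp [iterLift]

theorem iterLift_add_intCast (F : CircleDeg1Liftˣ) (j m n : ℤ) (x : ℝ) :
    iterLift F j m x + n = iterLift F j (m + n) x := by
  rw [iterLift, iterLift, Int.cast_add, add_assoc]

theorem iterLift_lt_iterLift
    (h : j * (F : CircleDeg1Lift).translationNumber + m <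
      k * (F : CircleDeg1Lift).translationNumber + l) (x : ℝ) :
    iterLift F j m x < iterLift F k l x := by
  have hlt := ((F ^ (k - j) : CircleDeg1Liftˣ) : CircleDeg1Lift).lt_map_of_int_lt_translationNumber
    (n := m - l) (by rw [CircleDeg1Lift.translationNumber_zpow]; push_cast; linarith)
    (iterLift F j m x)
  have hcomp := iterLift_comp F (k - j) (l - m) j m x
  rw [sub_add_cancel, sub_add_cancel, iterLift] at hcomp
  push_cast at hlt hcomp
  linarith

variable (hτ : Irrational (F : CircleDeg1Lift).translationNumber)
include hτ

theorem iterLift_le_iterLift_iff {x : ℝ} :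
    iterLift F j m x ≤ iterLift F k l x ↔
      j * (F : CircleDeg1Lift).translationNumber + m ≤
        k * (F : CircleDeg1Lift).translationNumber + l := by
  refine ⟨fun hle => not_lt.1 fun hlt => (iterLift_lt_iterLift hlt x).not_ge hle, fun hle => ?_⟩
  rcases hle.lt_or_eq with hlt | heq
  · exact (iterLift_lt_iterLift hlt x).le
  obtain rfl : j = k := by
    by_contra hjk
    refine (hτ.intCast_mul (sub_ne_zero.2 hjk)).ne_int (l - m) ?_
    push_cast
    linarith
  obtain rfl : m = l := by exact_mod_cast add_left_cancel heq
  exact le_rfl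

theorem iterLift_lt_iterLift_iff {x : ℝ} :
    iterLift F j m x < iterLift F k l x ↔
      j * (F : CircleDeg1Lift).translationNumber + m <
        k * (F : CircleDeg1Lift).translationNumber + l :=
  lt_iff_lt_of_le_iff_le (iterLift_le_iterLift_iff hτ)

theorem iterLift_mem_uIcc {i p : ℤ}
    (h : i * (F : CircleDeg1Lift).translationNumber + p ∈
      Set.uIcc (j * (F : CircleDeg1Lift).translationNumber + m)
        (k * (F : CircleDeg1Lift).translationNumber + l)) (x : ℝ) :
    iterLift F i p x ∈ Set.uIcc (iterLift F j m x) (iterLift F k l x) := by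
  simpa only [Set.mem_uIcc, iterLift_le_iterLift_iff hτ] using h

theorem exists_abs_iterLift_sub_le (hF : ContDiff ℝ 1 (F : CircleDeg1Lift))
    (hF' : ContDiff ℝ 1 ((F⁻¹ : CircleDeg1Liftˣ) : CircleDeg1Lift)) {ε : ℝ} (hε : 0 < ε) :
    ∃ C > 0, ∀ (j m : ℤ) (u v : ℝ),
      |iterLift F j m u - iterLift F j m v| ≤ C * Real.exp (ε * |j|) * |u - v| := by
  have hd := hF.differentiable one_ne_zero
  have hd' := hF'.differentiable one_ne_zero
  obtain ⟨C, hC, hpow⟩ := exists_abs_pow_sub_le hF (deriv_pos_of_differentiable_inv hd hd') hτ hε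
  obtain ⟨C', _, hpow'⟩ := exists_abs_pow_sub_le hF'
    (deriv_pos_of_differentiable_inv hd' (by rwa [inv_inv]))
    (by rw [CircleDeg1Lift.translationNumber_units_inv]; exact hτ.neg) hε
  refine ⟨max C C', lt_max_of_lt_left hC, fun j m u v => ?_⟩
  simp only [iterLift, add_sub_add_right_eq_sub]
  obtain ⟨n, rfl | rfl⟩ := Int.eq_nat_or_neg j
  · rw [zpow_natCast, Units.val_pow_eq_pow_val, Nat.abs_cast, Int.cast_natCast]
    refine (hpow n u v).trans ?_
    gcongr
    exact le_max_left _ _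
  · rw [zpow_neg, ← inv_zpow, zpow_natCast, Units.val_pow_eq_pow_val, abs_neg, Nat.abs_cast,
      Int.cast_natCast]
    refine (hpow' n u v).trans ?_
    gcongr
    exact le_max_right _ _

/-- Here `iterLift F j m` is the shorter displacement: it carries the longer arc over the shorter
one, while two steps of it backwards cover the longer arc. -/
theorem abs_sub_iterLift_le_and_le
    (hback : (0 : ℝ) ∈ Set.uIcc (j * (F : CircleDeg1Lift).translationNumber + m)
      ((j * (F : CircleDeg1Lift).translationNumber + m) +
        (k * (F : CircleDeg1Lift).translationNumber + l)))
    (hcover : k * (F : CircleDeg1Lift).translationNumber + l ∈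
      Set.uIcc 0 (-2 * (j * (F : CircleDeg1Lift).translationNumber + m))) {K : ℝ}
    (hK : ∀ i p : ℤ, |i| ≤ 2 * |j| → ∀ u v,
      |iterLift F i p u - iterLift F i p v| ≤ K * |u - v|) (x : ℝ) :
    |x - iterLift F j m x| ≤ K * |iterLift F k l x - x| ∧
      |iterLift F k l x - x| ≤ 2 * K * |x - iterLift F j m x| := by
  have hj := abs_nonneg j
  constructor
  · have hmem := iterLift_mem_uIcc hτ (i := 0) (p := 0) (j := j) (m := m) (k := j + k)
      (l := m + l) (by
        convert hback using 2 <;> push_cast <;> ring) x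
    rw [iterLift_zero, ← iterLift_comp] at hmem
    exact (Set.abs_sub_left_of_mem_uIcc hmem).trans (hK j m (by linarith) _ _)
  · have hmem := iterLift_mem_uIcc hτ (i := k) (p := l) (j := 0) (m := 0) (k := -2 * j)
      (l := -2 * m) (by
        convert hcover using 2 <;> push_cast <;> ring) x
    have hone := hK (-j) (-m) (by rw [abs_neg]; linarith) x (iterLift F j m x)
    have htwo := hK (-2 * j) (-2 * m) (by rw [abs_mul]; rfl) x (iterLift F j m x)
    rw [iterLift_comp, neg_add_cancel, neg_add_cancel, iterLift_zero] at hone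
    rw [iterLift_comp, show -2 * j + j = -j by ring, show -2 * m + m = -m by ring] at htwo
    rw [iterLift_zero] at hmem
    calc |iterLift F k l x - x| ≤ |iterLift F (-2 * j) (-2 * m) x - x| :=
          Set.abs_sub_left_of_mem_uIcc hmem
      _ ≤ |iterLift F (-2 * j) (-2 * m) x - iterLift F (-j) (-m) x| +
          |iterLift F (-j) (-m) x - x| := abs_sub_le _ _ _
      _ ≤ 2 * K * |x - iterLift F j m x| := by linarith

end IterLift

section CircleMap

theorem toCircleMap_coe (F : CircleDeg1Lift) (t : ℝ) :
    toCircleMap F t = ((F t : ℝ) : UnitAddCircle) := rfl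

theorem eq_toCircleMap {F : CircleDeg1Lift} {f : UnitAddCircle → UnitAddCircle}
    (hf : ∀ t : ℝ, f (t : UnitAddCircle) = ((F t : ℝ) : UnitAddCircle)) : f = toCircleMap F :=
  funext fun x => QuotientAddGroup.induction_on x hf

theorem leftInverse_toCircleMap_inv (F : CircleDeg1Liftˣ) :
    Function.LeftInverse (toCircleMap (F⁻¹ : CircleDeg1Liftˣ)) (toCircleMap F) := fun x => by
  obtain ⟨t, rfl⟩ := QuotientAddGroup.mk_surjective x
  rw [toCircleMap_coe, toCircleMap_coe, CircleDeg1Lift.units_inv_apply_apply]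

theorem iterate_toCircleMap_coe (F : CircleDeg1Liftˣ) (i : ℕ) (m : ℤ) (t : ℝ) :
    (toCircleMap F)^[i] t = ((iterLift F i m t : ℝ) : UnitAddCircle) := by
  rw [iterLift, coe_add_intCast, zpow_natCast, Units.val_pow_eq_pow_val]
  induction i with
  | zero => simp
  | succ i ih =>
    rw [Function.iterate_succ_apply', ih, toCircleMap_coe, pow_succ', CircleDeg1Lift.mul_apply]

theorem orbitSegment_of_leftInverse {f g : UnitAddCircle → UnitAddCircle}
    (hgf : Function.LeftInverse g f) (n : ℕ) (x : UnitAddCircle) :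
    orbitSegment g n (f^[n] x) = orbitSegment f n x := by
  have hback (j : ℕ) (hj : j ≤ n) : g^[j] (f^[n] x) = f^[n - j] x := by
    obtain ⟨i, rfl⟩ := Nat.exists_eq_add_of_le hj
    rw [Function.iterate_add_apply, hgf.iterate j, Nat.add_sub_cancel_left]
  ext y
  constructor
  · rintro ⟨j, hj, rfl⟩
    exact ⟨n - j, Nat.sub_le n j, hback j hj⟩
  · rintro ⟨j, hj, rfl⟩
    exact ⟨n - j, Nat.sub_le n j, by rw [hback _ (Nat.sub_le n j), Nat.sub_sub_self hj]⟩

theorem isInitialRatio_iterate_iff_isFinalRatio {f g : UnitAddCircle → UnitAddCircle}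
    (hgf : Function.LeftInverse g f) {n : ℕ} {x : UnitAddCircle} {ρ : ℝ} :
    IsInitialRatio g n (f^[n] x) ρ ↔ IsFinalRatio f n x ρ := by
  rw [IsInitialRatio, IsFinalRatio, orbitSegment_of_leftInverse hgf]

end CircleMap

namespace IsNeighbourPair

variable {F : CircleDeg1Liftˣ} {r s : ℕ} {a b : ℝ} {p q : ℤ}

theorem isInitialRatio_toCircleMap
    (h : IsNeighbourPair (F : CircleDeg1Lift).translationNumber r s a b)
    (hτ : Irrational (F : CircleDeg1Lift).translationNumber)
    (hp : r * (F : CircleDeg1Lift).translationNumber + p = -a)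
    (hq : s * (F : CircleDeg1Lift).translationNumber + q = b) (hr : 1 < r) (hs : 1 < s) (t : ℝ) :
    IsInitialRatio (toCircleMap F) (r + s - 2) t
      ((t - iterLift F r p t) / (iterLift F s q t - t)) := by
  have hab := h.gap_add_gap_lt_one hr
  have ha := h.left_gap_pos
  have hb := h.right_gap_pos
  have hleft : iterLift F r p t < t := by
    conv_rhs => rw [← iterLift_zero F t]
    exact iterLift_lt_iterLift (by push_cast; linarith) t
  have hright : t < iterLift F s q t := by
    conv_lhs => rw [← iterLift_zero F t]
    exact iterLift_lt_iterLift (by push_cast; linarith) t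
  have hlength : iterLift F s q t < iterLift F r p t + 1 := by
    rw [← Int.cast_one, iterLift_add_intCast]
    exact iterLift_lt_iterLift (by push_cast; linarith) t
  refine ⟨iterLift F r p t, iterLift F s q t, ⟨⟨r, by omega, ?_⟩, ⟨s, by omega, ?_⟩, ?_⟩, ?_⟩
  · exact (iterate_toCircleMap_coe F r p t).symm
  · exact (iterate_toCircleMap_coe F s q t).symm
  · refine Set.eq_singleton_iff_unique_mem.2 ⟨⟨?_, 0, Nat.zero_le _, rfl⟩, ?_⟩
    · rw [coe_mem_cIoo_iff (hleft.trans hright).le hlength]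
      exact ⟨0, by rw [Int.cast_zero, add_zero]; exact ⟨hleft, hright⟩⟩
    rintro _ ⟨hmem, i, hi, rfl⟩
    rw [iterate_toCircleMap_coe F i 0, coe_mem_cIoo_iff (hleft.trans hright).le hlength] at hmem
    obtain ⟨m, hm⟩ := hmem
    rw [iterLift_add_intCast, zero_add, Set.mem_Ioo, iterLift_lt_iterLift_iff hτ,
      iterLift_lt_iterLift_iff hτ, Int.cast_natCast, Int.cast_natCast, Int.cast_natCast, hp, hq]
      at hm
    rw [h.eq_zero_of_mem i (by omega) m hm, Function.iterate_zero_apply]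
  · rw [arcLength_coe_of_le hleft.le (by linarith), arcLength_coe_of_le hright.le (by linarith)]

theorem abs_sub_iterLift_le
    (h : IsNeighbourPair (F : CircleDeg1Lift).translationNumber r s a b)
    (hbal : IsBalanced r s a b) (hτ : Irrational (F : CircleDeg1Lift).translationNumber)
    (hp : r * (F : CircleDeg1Lift).translationNumber + p = -a)
    (hq : s * (F : CircleDeg1Lift).translationNumber + q = b) {K : ℝ} (hK₀ : 0 ≤ K)
    (hK : ∀ i m : ℤ, |i| ≤ 4 * min r s → ∀ u v,
      |iterLift F i m u - iterLift F i m v| ≤ K * |u - v|) (x : ℝ) :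
    |x - iterLift F r p x| ≤ 2 * K * |iterLift F s q x - x| ∧
      |iterLift F s q x - x| ≤ 2 * K * |x - iterLift F r p x| := by
  have ha := h.left_gap_pos
  have hb := h.right_gap_pos
  have hKle (y : ℝ) : K * |y| ≤ 2 * K * |y| := by
    gcongr
    linarith
  rcases hbal with ⟨hab, hba, htime⟩ | ⟨hba, hab, htime⟩
  · obtain ⟨hshort, hlong⟩ := abs_sub_iterLift_le_and_le hτ (j := r) (m := p) (k := s) (l := q)
      (by rw [Int.cast_natCast, Int.cast_natCast, hp, hq, Set.mem_uIcc]
          exact Or.inl ⟨by linarith, by linarith⟩)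
      (by rw [Int.cast_natCast, Int.cast_natCast, hp, hq, Set.mem_uIcc]
          exact Or.inl ⟨by linarith, by linarith⟩)
      (fun i m hi => hK i m (hi.trans (by rw [Nat.abs_cast]; omega))) x
    exact ⟨hshort.trans (hKle _), hlong⟩
  · obtain ⟨hshort, hlong⟩ := abs_sub_iterLift_le_and_le hτ (j := s) (m := q) (k := r) (l := p)
      (by rw [Int.cast_natCast, Int.cast_natCast, hp, hq, Set.mem_uIcc]
          exact Or.inr ⟨by linarith, by linarith⟩)
      (by rw [Int.cast_natCast, Int.cast_natCast, hp, hq, Set.mem_uIcc]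
          exact Or.inr ⟨by linarith, by linarith⟩)
      (fun i m hi => hK i m (hi.trans (by rw [Nat.abs_cast]; omega))) x
    rw [abs_sub_comm x (iterLift F r p x), abs_sub_comm (iterLift F s q x) x]
    exact ⟨hlong, hshort.trans (hKle _)⟩

theorem exists_isInitialRatio_mem_Icc
    (h : IsNeighbourPair (F : CircleDeg1Lift).translationNumber r s a b)
    (hbal : IsBalanced r s a b) (hτ : Irrational (F : CircleDeg1Lift).translationNumber)
    (hr : 1 < r) (hs : 1 < s) {K : ℝ} (hK₀ : 0 < K)
    (hK : ∀ i m : ℤ, |i| ≤ 4 * min r s → ∀ u v,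
      |iterLift F i m u - iterLift F i m v| ≤ K * |u - v|) (x : UnitAddCircle) :
    ∃ ρ ∈ Set.Icc (2 * K)⁻¹ (2 * K), IsInitialRatio (toCircleMap F) (r + s - 2) x ρ := by
  obtain ⟨t, rfl⟩ := QuotientAddGroup.mk_surjective x
  obtain ⟨p, hp⟩ := h.exists_left
  obtain ⟨q, hq⟩ := h.exists_right
  refine ⟨_, ?_, h.isInitialRatio_toCircleMap hτ hp hq hr hs t⟩
  obtain ⟨hle, hge⟩ := h.abs_sub_iterLift_le hbal hτ hp hq hK₀.le hK t
  have hleft : 0 < t - iterLift F r p t := by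
    rw [sub_pos]
    conv_rhs => rw [← iterLift_zero F t]
    exact iterLift_lt_iterLift (by push_cast; linarith [h.left_gap_pos]) t
  have hright : 0 < iterLift F s q t - t := by
    rw [sub_pos]
    conv_lhs => rw [← iterLift_zero F t]
    exact iterLift_lt_iterLift (by push_cast; linarith [h.right_gap_pos]) t
  rw [abs_of_pos hleft, abs_of_pos hright] at hle hge
  rw [Set.mem_Icc, le_div_iff₀ hright, inv_mul_le_iff₀ (by positivity), div_le_iff₀ hright]
  exact ⟨hge, hle⟩

theorem Icc_exp_subset_Icc_pow {τ : ℝ} {r s : ℕ} {a b : ℝ} (h : IsNeighbourPair τ r s a b)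
    (hmin : 8 < min r s) {lam : ℝ} (hlam : 1 < lam) :
    Set.Icc (Real.exp (Real.log lam / 4 * min r s))⁻¹ (Real.exp (Real.log lam / 4 * min r s)) ⊆
      Set.Icc (lam ^ (-(wanderingTime (τ : UnitAddCircle) (r + s - 2) : ℤ)))
        (lam ^ wanderingTime (τ : UnitAddCircle) (r + s - 2)) := by
  have htime : min r s ≤ 4 * wanderingTime (τ : UnitAddCircle) (r + s - 2) := by
    have := h.min_time_le_wanderingTime
    omega
  generalize wanderingTime (τ : UnitAddCircle) (r + s - 2) = w at htime ⊢
  have hexp : Real.exp (Real.log lam / 4 * min r s) ≤ lam ^ w := calc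
    _ ≤ Real.exp (Real.log lam / 4 * (4 * w)) := by
      have hlog := Real.log_pos hlam
      gcongr
      exact_mod_cast htime
    _ = Real.exp (w * Real.log lam) := by ring_nf
    _ = lam ^ w := by rw [Real.exp_nat_mul, Real.exp_log (by linarith)]
  rw [zpow_neg, zpow_natCast]
  exact Set.Icc_subset_Icc (inv_anti₀ (Real.exp_pos _) hexp) hexp

end IsNeighbourPair

section Ratios

variable {F : CircleDeg1Liftˣ} (hF : ContDiff ℝ 1 (F : CircleDeg1Lift))
  (hF' : ContDiff ℝ 1 ((F⁻¹ : CircleDeg1Liftˣ) : CircleDeg1Lift))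
  (hτ : Irrational (F : CircleDeg1Lift).translationNumber)
include hF hF' hτ

theorem eventually_exists_isInitialRatio {ε : ℝ} (hε : 0 < ε) :
    ∀ᶠ n : ℕ in Filter.atTop, ∀ r s a b,
      IsNeighbourPair (F : CircleDeg1Lift).translationNumber r s a b → IsBalanced r s a b →
      n ≤ r + s → ∀ x, ∃ ρ ∈ Set.Icc (Real.exp (ε * min r s))⁻¹ (Real.exp (ε * min r s)),
        IsInitialRatio (toCircleMap F) (r + s - 2) x ρ := by
  obtain ⟨C, hC, hlip⟩ := exists_abs_iterLift_sub_le hτ hF hF' (show 0 < ε / 8 by positivity)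
  obtain ⟨M, hM⟩ := exists_nat_ge (Real.log (2 * C) / (ε / 2))
  rw [div_le_iff₀ (by positivity)] at hM
  filter_upwards [IsNeighbourPair.eventually_lt_min_time hτ (M + 1)] with n hn r s a b h hbal hrs x
  have hmin := hn r s a b h hbal hrs
  set μ := min r s
  have hconst : 2 * C ≤ Real.exp (ε / 2 * μ) := by
    rw [← Real.log_le_iff_le_exp (by positivity), mul_comm (ε / 2)]
    refine hM.trans ?_
    gcongr
    omega
  have hdist : 2 * (C * Real.exp (ε / 8 * (4 * μ))) ≤ Real.exp (ε * μ) := calc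
    _ = 2 * C * Real.exp (ε / 2 * μ) := by ring_nf
    _ ≤ Real.exp (ε / 2 * μ) * Real.exp (ε / 2 * μ) := by gcongr
    _ = Real.exp (ε * μ) := by rw [← Real.exp_add]; ring_nf
  obtain ⟨ρ, hρ, hratio⟩ := h.exists_isInitialRatio_mem_Icc hbal hτ (by omega) (by omega)
    (show 0 < C * Real.exp (ε / 8 * (4 * μ)) by positivity)
    (fun i m hi u v => (hlip i m u v).trans (by gcongr; exact_mod_cast hi)) x
  exact ⟨ρ, Set.Icc_subset_Icc (inv_anti₀ (by positivity) hdist) hdist hρ, hratio⟩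

theorem eventually_exists_isFinalRatio {ε : ℝ} (hε : 0 < ε) :
    ∀ᶠ n : ℕ in Filter.atTop, ∀ r s a b,
      IsNeighbourPair (F : CircleDeg1Lift).translationNumber r s a b → IsBalanced r s a b →
      n ≤ r + s → ∀ x, ∃ ρ ∈ Set.Icc (Real.exp (ε * min r s))⁻¹ (Real.exp (ε * min r s)),
        IsFinalRatio (toCircleMap F) (r + s - 2) x ρ := by
  have hinv := CircleDeg1Lift.translationNumber_units_inv F
  filter_upwards [eventually_exists_isInitialRatio hF' (by rwa [inv_inv]) (hinv ▸ hτ.neg) hε]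
    with n hn r s a b h hbal hrs x
  obtain ⟨ρ, hρ, hratio⟩ := hn s r b a (hinv ▸ h.neg) hbal.symm (add_comm r s ▸ hrs)
    ((toCircleMap F)^[r + s - 2] x)
  rw [min_comm] at hρ
  rw [add_comm s r] at hratio
  exact ⟨ρ, hρ, (isInitialRatio_iterate_iff_isFinalRatio (leftInverse_toCircleMap_inv F)).1 hratio⟩

end Ratios

theorem mainTheorem5 (α : ℝ) (hα : Irrational α) :
    (∃ k : ℕ → ℕ, IsCharacteristicSequence (α : UnitAddCircle) k) ∧
    ∀ k : ℕ → ℕ, IsCharacteristicSequence (α : UnitAddCircle) k →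
      ∀ f ∈ FOne (α : UnitAddCircle), ∀ lam : ℝ, 1 < lam →
        ∃ i₀ : ℕ, ∀ i : ℕ, i₀ ≤ i → ∀ x : UnitAddCircle,
          ∃ ρ₀ ρ₁ : ℝ, IsInitialRatio f (k i) x ρ₀ ∧ IsFinalRatio f (k i) x ρ₁ ∧
            ρ₀ ∈ Set.Icc (lam ^ (-(wanderingTime (α : UnitAddCircle) (k i) : ℤ)))
              (lam ^ wanderingTime (α : UnitAddCircle) (k i)) ∧
            ρ₁ ∈ Set.Icc (lam ^ (-(wanderingTime (α : UnitAddCircle) (k i) : ℤ)))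
              (lam ^ wanderingTime (α : UnitAddCircle) (k i)) := by
  refine ⟨exists_isCharacteristicSequence hα, ?_⟩
  rintro k ⟨N, hN, hpre, hk⟩ f ⟨F, hF, hF', hf, hFα⟩ lam hlam
  obtain ⟨m, hm⟩ := coe_eq_coe_iff_exists_add_intCast.1 hFα.symm
  have hτ : Irrational (F : CircleDeg1Lift).translationNumber := hm ▸ hα.add_intCast m
  obtain rfl := eq_toCircleMap hf
  have hε : 0 < Real.log lam / 4 := div_pos (Real.log_pos hlam) four_pos
  obtain ⟨i₀, hi₀⟩ := Filter.eventually_atTop.1 <|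
    (eventually_exists_isInitialRatio hF hF' hτ hε).and <|
    (eventually_exists_isFinalRatio hF hF' hτ hε).and <|
    (IsNeighbourPair.eventually_lt_min_time hτ 8).and (Filter.eventually_ge_atTop 1)
  refine ⟨i₀, fun i hi x => ?_⟩
  obtain ⟨hinit, hfinal, hmin, hNi⟩ := hi₀ (N i) (hi.trans hN.le_apply)
  rw [← hFα] at hpre ⊢
  obtain ⟨r, s, a, b, h, hbal, hrs⟩ := (hpre i).exists_isNeighbourPair hτ hNi
  have hki : k i = r + s - 2 := by rw [hk]; omega
  obtain ⟨ρ₀, hρ₀, hratio₀⟩ := hinit r s a b h hbal (by omega) x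
  obtain ⟨ρ₁, hρ₁, hratio₁⟩ := hfinal r s a b h hbal (by omega) x
  rw [hki]
  have hsub := h.Icc_exp_subset_Icc_pow (hmin r s a b h hbal (by omega)) hlam
  exact ⟨ρ₀, ρ₁, hratio₀, hratio₁, hsub hρ₀, hsub hρ₁⟩
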